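/- **Setting.** Let $N,M\in\mathbb N$, let $\nu_1,\dots,\nu_M\in\mathbb Z^N$ be stoichiometric vectors and $a_1,\dots,a_M:\mathbb Z^N\to[0,\infty)$ propensity functions, $a_0=\sum_j a_j$. The associated chemical process $X(t)$, $t\ge 0$, is the càdlàg $\mathbb Z^N$-valued Markov process which, in state $x$, waits an exponential time of rate $a_0(x)$ and then jumps by $\nu_j$ with probability $a_j(x)/a_0(x)$. It is assumed non-explosive (from every initial state, almost surely only finitely many reactions fire in a finite time interval). Let $P(\tau,x,x')$ be its transition function. A tau leap method is a map $\phi:[0,\infty)\times\mathbb Z^N\times\mathbb Z^N\to[0,1]$ with $\sum_{x'}\phi(\tau,x,x')=1$ for all $\tau,x$. A mesh on $[0,T]$ is $\Pi=(t_0,\dots,t_n)$ with $0=t_0<\dots<t_n=T$; put $\tau_j=t_j-t_{j-1}$ and $\tau=|\Pi|=\max_j\tau_j$. The tau leap solution $Y_\Pi$ is the process on $[0,T]$ that is constant on each $[t_{j-1},t_j)$ and makes Markovian transitions with kernel $\phi(\tau_j)$ from time $t_{j-1}$ to time $t_j$. Fix a norm $|\cdot|$ on $\mathbb R^N$. For $r\in\mathbb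 Z_+$ and $g:\mathbb Z^N\to\mathbb R$ let $|g|_r=\sum_x\frac12(1+|x|^r)|g(x)|\in[0,\infty]$ (with $|x|^0=1$, so that $|g|_0=\sum_x|g(x)|$ is the total variation norm), and let $\mathcal M$ be the set of $g$ with $|g|_r<\infty$ for all $r$. For a matrix $\psi$ put $(\psi g)(y)=\sum_x\psi(x,y)g(x)$. Superscripts $(i)$ denote $i$-th derivatives in $\tau\in[0,\infty)$, one-sided at $0$. Let $q\in\mathbb Z_+$. **Assumptions.** 1. There is $s^*\in\mathbb Z_+$ such that for every $j$ there is $\alpha>0$ with $|a_j(x)|\le\alpha(|x|^{s^*}+1)$ for all $x$. 2. For every $r\in\mathbb Z_+$, $\lambda_r>0$ is such that $\sum_{x'}(1+|x'|^r)P(\tau,x,x')\le(1+|x|^r)e^{\lambda_r\tau}$ for all $\tau>0$ and $x$. 3. For all $x,x'$, $\phi(\cdot,x,x')$ is $q+1$ times continuously differentiable on $[0,\infty)$ and $\phi^{(i)}(0,x,x')=P^{(i)}(0,x,x')$ for $i=0,1,\dots,q$ (for $i=0$: $\phi(0,x,x')=1$ if $x=x'$ and $0$ otherwise). 4. There are $H_1>0$,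 $s_1\in\mathbb Z_+$ with $s_1>0$, $\delta_0>0$ and $\gamma_1>0$ such that $\sum_{x'}|\phi^{(q+1)}(\tau,x,x')|\le\frac{H_1}2(|x|^{s_1}+1)e^{\gamma_1\tau}$ for all $\tau\in[0,\delta_0)$ and all $x$. (No moment stability of the tau leap method is assumed.) **Conclusion.** (a) There are $H_0\ge H_1$, $s_0\ge s_1$ in $\mathbb Z_+$ and $\gamma_0\ge\gamma_1$ such that for all $x$ $$\sum_{x'}|\phi^{(q+1)}(\tau,x,x')|\le\tfrac{H_0}2(|x|^{s_0}+1)e^{\gamma_0\tau}\ (0\le\tau<\delta_0),\qquad \sum_{x'}|P^{(q+1)}(\tau,x,x')|\le\tfrac{H_0}2(|x|^{s_0}+1)e^{\gamma_0\tau}\ (\tau>0).\tag{$*$}$$ (b) Let $H_0>0$, $s_0\in\mathbb Z_+$ with $s_0>0$, and $\gamma_0>0$ be any constants satisfying $(*)$. Then there is $C_0>0$ such that $$|(\phi(\tau)-P(\tau))g|_0\le C_0\,|g|_{s_0}\,\tau^{q+1}e^{\gamma_0\tau}\qquad\text{for all }\tau\in[0,\delta_0),\ g\in\mathcal M.\tag{$**$}$$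 (c) (Order $q$ convergence in total variation.) For $H_0,s_0,\gamma_0$ as in (b), for every $C_0>0$ satisfying $(**)$, and with $\mu_0=\max\{\lambda_{s_0},\gamma_0\}$, the following holds for every $T$, every mesh $\Pi=(t_0,\dots,t_n)$ on $[0,T]$ with $\tau=|\Pi|<\delta_0$ and every probability mass function $p_0\in\mathcal M$: if $X$ and $Y_\Pi$ are started with distribution $p_0$ and $p(t)$, $\hat p_\Pi(t)$ denote the probability mass functions of $X(t)$, $Y_\Pi(t)$, then for $i=0,1,\dots,n$ $$|\hat p_\Pi(t_i)-p(t_i)|_0\le C_0\,|p_0|_{s_0}\,t_i\,e^{\mu_0t_i}\,\tau^q\le C_0\,|p_0|_{s_0}\,T\,e^{\mu_0T}\,\tau^q.$$ -/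

import Mathlib

open scoped ENNReal NNReal Topology MeasureTheory

noncomputable section

namespace TauLeap

/-- The state space `ℤ^N`. -/
abbrev State (N : ℕ) : Type := Fin N → ℤ

/-- Stoichiometric vectors `ν j` and nonnegative propensities (intensities) `a j`, `j = 1, …, M`. -/
structure ChemicalSystem (N M : ℕ) where
  ν : Fin M → State N
  a : Fin M → State N → ℝ
  a_nonneg : ∀ j x, 0 ≤ a j x

namespace ChemicalSystem

variable {N M : ℕ} (S : ChemicalSystem N M)

/-- The total jump rate `a₀(x) = ∑ j, a j x`. -/
def rate (x : State N) : ℝ := ∑ j, S.a j x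

/-- `S.jumpProb n t x y` is the probability that, starting from `x`, exactly `n` reactions fire
during `(0, t]` and that the state at time `t` is `y`. The waiting time for the first reaction is
exponential with rate `a₀(x)` and this reaction is the `j`-th one with probability
`a j x / a₀(x)`, so that the `j`-th reaction fires first, at time `s`, with density
`a j x * exp (- a₀(x) * s)`; then the process starts afresh from `x + ν j`. -/
def jumpProb : ℕ → ℝ → State N → State N → ℝ≥0∞
  | 0, t, x, y => if x = y then ENNReal.ofReal (Real.exp (-(S.rate x * t))) else 0
  | n + 1, t, x, y =>
      ∑ j, ∫⁻ s in Set.Icc 0 t,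
        ENNReal.ofReal (S.a j x * Real.exp (-(S.rate x * s))) * jumpProb n (t - s) (x + S.ν j) y

/-- The transition function `P(t, x, y)` of the chemical process. -/
def trans (t : ℝ) (x y : State N) : ℝ := (∑' n, S.jumpProb n t x y).toReal

/-- Non-explosivity: from every initial state, almost surely only finitely many reactions fire in
a finite time interval. -/
def NonExplosive : Prop :=
  ∀ t : ℝ, 0 ≤ t → ∀ x : State N, ∑' y, ∑' n, S.jumpProb n t x y = 1

end ChemicalSystem

section Processes

variable {N : ℕ} {Ω : Type*}

/-- The σ-algebra generated by `X u`, `u ≤ s`. -/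
@[reducible] def history (X : ℝ≥0 → Ω → State N) (s : ℝ≥0) : MeasurableSpace Ω :=
  ⨆ u ∈ Set.Iic s, MeasurableSpace.comap (X u) inferInstance

/-- The probability mass function of a random state `Z`. -/
def law [MeasurableSpace Ω] (ℙ : MeasureTheory.Measure Ω) (Z : Ω → State N) (x : State N) : ℝ :=
  ℙ.real {ω | Z ω = x}

/-- `X` is a version with càdlàg paths of the chemical process with initial distribution `p₀`:
a Markov process with the transition function of the chemical system. -/
structure IsChemicalProcess {M : ℕ} (S : ChemicalSystem N M) (p₀ : PMF (State N))
    [MeasurableSpace Ω] (ℙ : MeasureTheory.Measure Ω) (X : ℝ≥0 → Ω → State N) : Prop where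
  measurable : ∀ t, Measurable (X t)
  initial : ∀ x, ℙ {ω | X 0 ω = x} = p₀ x
  markov : ∀ (s t : ℝ≥0) (A : Set Ω), MeasurableSet[history X s] A → ∀ x y : State N,
    ℙ.real (A ∩ {ω | X s ω = x} ∩ {ω | X (s + t) ω = y}) =
      ℙ.real (A ∩ {ω | X s ω = x}) * S.trans t x y
  cadlag : ∀ᵐ ω ∂ℙ, ∀ t : ℝ≥0,
    ContinuousWithinAt (fun s => X s ω) (Set.Ici t) t ∧
      (0 < t → ∃ l, Filter.Tendsto (fun s => X s ω) (𝓝[<] t) (𝓝 l))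

/-- A tau leap method assigns to each time step `τ ≥ 0` and each state `x` a probability mass
function `φ τ x`. -/
structure IsTauLeapMethod (φ : ℝ → State N → State N → ℝ) : Prop where
  nonneg : ∀ τ, 0 ≤ τ → ∀ x y, 0 ≤ φ τ x y
  hasSum_one : ∀ τ, 0 ≤ τ → ∀ x, HasSum (φ τ x) 1

/-- A mesh `0 = t₀ < t₁ < ⋯ < t_n = T`. -/
structure Mesh (T : ℝ≥0) (n : ℕ) where
  t : Fin (n + 1) → ℝ≥0
  strictMono : StrictMono t
  t_zero : t 0 = 0
  t_last : t (Fin.last n) = T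

/-- The step size `t_{j+1} - t_j`. -/
def Mesh.step {T : ℝ≥0} {n : ℕ} (m : Mesh T n) (j : Fin n) : ℝ :=
  (m.t j.succ : ℝ) - (m.t j.castSucc : ℝ)

/-- The maximum step size `|Π|`. -/
def Mesh.size {T : ℝ≥0} {n : ℕ} (m : Mesh T n) : ℝ := ⨆ j, m.step j

/-- `Y` is the tau leap solution on the mesh `m` with initial distribution `p₀`: it is constant
on each `[t_j, t_{j+1})`, and makes Markovian transitions with kernel `φ (t_{j+1} - t_j)` from
time `t_j` to time `t_{j+1}`. -/
structure IsTauLeapSolution (φ : ℝ → State N → State N → ℝ) {T : ℝ≥0} {n : ℕ} (m : Mesh T n)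
    (p₀ : PMF (State N)) [MeasurableSpace Ω] (ℙ : MeasureTheory.Measure Ω)
    (Y : ℝ≥0 → Ω → State N) : Prop where
  measurable : ∀ t, t ≤ T → Measurable (Y t)
  initial : ∀ x, ℙ {ω | Y 0 ω = x} = p₀ x
  const : ∀ (j : Fin n) (s : ℝ≥0), m.t j.castSucc ≤ s → s < m.t j.succ →
    ∀ ω, Y s ω = Y (m.t j.castSucc) ω
  markov : ∀ (j : Fin n) (A : Set Ω), MeasurableSet[history Y (m.t j.castSucc)] A →
    ∀ x y : State N,
      ℙ.real (A ∩ {ω | Y (m.t j.castSucc) ω = x} ∩ {ω | Y (m.t j.succ) ω = y}) =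
        ℙ.real (A ∩ {ω | Y (m.t j.castSucc) ω = x}) * φ (m.step j) x y

end Processes

section Norms

variable {N : ℕ} (nrm : Seminorm ℝ (Fin N → ℝ))

/-- `|x|` for `x ∈ ℤ^N ⊆ ℝ^N`. -/
def size (x : State N) : ℝ := nrm (fun i => (x i : ℝ))

/-- The `r`-th moment variation `|g|_r = ∑ x, (1 + |x|^r) / 2 * |g x| ≤ ∞`. -/
def momVar (r : ℕ) (g : State N → ℝ) : ℝ≥0∞ :=
  ∑' x, ENNReal.ofReal ((1 + size nrm x ^ r) / 2 * |g x|)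

/-- Membership in `𝓜 = ⋂ r, 𝓜_r`: all moment variations are finite. -/
def InM (g : State N → ℝ) : Prop := ∀ r : ℕ, momVar nrm r g < ∞

/-- The action `(ψ g)(y) = ∑ x, ψ(x, y) g(x)` of an infinite matrix. -/
def act (ψ : State N → State N → ℝ) (g : State N → ℝ) (y : State N) : ℝ := ∑' x, ψ x y * g x

/-- The `k`-th derivative in `τ ∈ [0, ∞)` (one-sided at `0`) of the entry `(x, y)` of `ψ`. -/
def entryDeriv (k : ℕ) (ψ : ℝ → State N → State N → ℝ) (τ : ℝ) (x y : State N) : ℝ :=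
  iteratedDerivWithin k (fun σ => ψ σ x y) (Set.Ici 0) τ

/-- All propensities are in the class `𝓒_s` for some `s`. -/
def PolyGrowth {M : ℕ} (S : ChemicalSystem N M) : Prop :=
  ∃ s : ℕ, ∀ j, ∃ α : ℝ, 0 < α ∧ ∀ x, |S.a j x| ≤ α * (size nrm x ^ s + 1)

/-- Exponential moment growth bound for `P`, with rates `lam r`. -/
def ExpMomentGrowth {M : ℕ} (S : ChemicalSystem N M) (lam : ℕ → ℝ) : Prop :=
  ∀ r : ℕ, 0 < lam r ∧ ∀ τ : ℝ, 0 < τ → ∀ x : State N,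
    ∑' y, ENNReal.ofReal ((1 + size nrm y ^ r) * S.trans τ x y) ≤
      ENNReal.ofReal ((1 + size nrm x ^ r) * Real.exp (lam r * τ))

/-- Pointwise consistency of order `q`; the case `i = 0` says that `φ 0` is the identity. -/
def PointwiseConsistent {M : ℕ} (S : ChemicalSystem N M) (φ : ℝ → State N → State N → ℝ)
    (q : ℕ) : Prop :=
  ∀ x y : State N,
    ContDiffOn ℝ ((q + 1 : ℕ) : WithTop ℕ∞) (fun τ => φ τ x y) (Set.Ici 0) ∧
      ∀ i ≤ q, entryDeriv i φ 0 x y = entryDeriv i S.trans 0 x y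

/-- The bound
`∑ y, |ψ^{(k)}(τ, x, y)| ≤ (H / 2) (|x|^s + 1) exp (γ τ)` for all `τ ∈ I` and all `x`. -/
def TVDerivBound (ψ : ℝ → State N → State N → ℝ) (k : ℕ) (I : Set ℝ) (H : ℝ) (s : ℕ) (γ : ℝ) :
    Prop :=
  ∀ τ ∈ I, ∀ x : State N,
    ∑' y, ENNReal.ofReal |entryDeriv k ψ τ x y| ≤
      ENNReal.ofReal (H / 2 * (size nrm x ^ s + 1) * Real.exp (γ * τ))

/-- The one-step estimate
`|(φ(τ) - P(τ)) g|_0 ≤ C |g|_s τ^{q+1} exp (γ τ)` for all `τ ∈ [0, δ)` and `g ∈ 𝓜`. -/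
def TVConsistent {M : ℕ} (S : ChemicalSystem N M) (φ : ℝ → State N → State N → ℝ) (q : ℕ)
    (C : ℝ) (s : ℕ) (δ γ : ℝ) : Prop :=
  ∀ τ ∈ Set.Ico 0 δ, ∀ g : State N → ℝ, InM nrm g →
    momVar nrm 0 (act (fun x y => φ τ x y - S.trans τ x y) g) ≤
      ENNReal.ofReal C * momVar nrm s g * ENNReal.ofReal (τ ^ (q + 1) * Real.exp (γ * τ))

end Norms

end TauLeap

end

/-! The argument is "consistency plus stability implies convergence" in total variation.
Conditioning on the first reaction gives a renewal equation for `P`, hence the backward equation, so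
that `P^(k)` is the `k`-fold generator applied to `P` in its initial state. Each generator step
costs a factor of polynomial growth, while the rows of `P` have mass one; this yields (a)
(`NonExplosive.exists_tsum_genIter_le`).

For (b), `φ - P` has vanishing derivatives up to order `q` at `0`, and Taylor's formula is
integrated in the `ℓ¹` norm over the target state (`tsum_ofReal_abs_le_of_deriv`).

For (c), the error after a step is `φ` applied to the old error plus the local defect `φ - P`
applied to the exact law (`act_sub_act`). The first term does not grow, since `φ` is stochastic; the
second needs moments of the exact process only. Hence no moment stability of `φ` is required. -/

namespace TauLeap

open MeasureTheory Set

/-! ### The transition function: renewal equation and backward equation. -/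

namespace ChemicalSystem

variable {N M : ℕ} (S : ChemicalSystem N M)

theorem measurable_jumpProb (n : ℕ) (x y : State N) :
    Measurable fun t => S.jumpProb n t x y := by
  induction n generalizing x y with
  | zero =>
    simp only [jumpProb]
    split_ifs
    · fun_prop
    · exact measurable_const
  | succ n ih =>
    simp only [jumpProb]
    refine Finset.measurable_fun_sum _ fun j _ => ?_
    -- The domain of integration depends on `t`; an indicator of a planar set turns this into an
    -- ordinary parametric integral.
    have hset : MeasurableSet {p : ℝ × ℝ | 0 ≤ p.2 ∧ p.2 ≤ p.1} :=
      (measurableSet_le measurable_const measurable_snd).inter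
        (measurableSet_le measurable_snd measurable_fst)
    have hF : Measurable fun p : ℝ × ℝ =>
        ENNReal.ofReal (S.a j x * Real.exp (-(S.rate x * p.2))) *
          S.jumpProb n (p.1 - p.2) (x + S.ν j) y :=
      Measurable.mul (by fun_prop) ((ih _ _).comp (by fun_prop))
    have h := (hF.indicator hset).lintegral_prod_right' (ν := volume)
    convert h using 2 with t
    rw [← lintegral_indicator measurableSet_Icc]
    rfl

theorem measurable_tsum_jumpProb (x y : State N) :
    Measurable fun t => ∑' n, S.jumpProb n t x y :=
  Measurable.tsum fun n => S.measurable_jumpProb n x y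

theorem measurable_trans (x y : State N) : Measurable fun t => S.trans t x y :=
  (S.measurable_tsum_jumpProb x y).ennreal_toReal

theorem trans_nonneg (t : ℝ) (x y : State N) : 0 ≤ S.trans t x y := ENNReal.toReal_nonneg

variable {S}

theorem NonExplosive.tsum_jumpProb_le_one (hS : S.NonExplosive) {t : ℝ} (ht : 0 ≤ t)
    (x y : State N) : ∑' n, S.jumpProb n t x y ≤ 1 :=
  (ENNReal.le_tsum y).trans (hS t ht x).le

theorem NonExplosive.ofReal_trans (hS : S.NonExplosive) {t : ℝ} (ht : 0 ≤ t) (x y : State N) :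
    ENNReal.ofReal (S.trans t x y) = ∑' n, S.jumpProb n t x y :=
  ENNReal.ofReal_toReal ((hS.tsum_jumpProb_le_one ht x y).trans_lt ENNReal.one_lt_top).ne

theorem NonExplosive.trans_le_one (hS : S.NonExplosive) {t : ℝ} (ht : 0 ≤ t) (x y : State N) :
    S.trans t x y ≤ 1 :=
  ENNReal.toReal_le_of_le_ofReal zero_le_one (by simpa using hS.tsum_jumpProb_le_one ht x y)

variable (S)

/-- The renewal equation: decomposition according to the first reaction. -/
theorem tsum_jumpProb_eq (t : ℝ) (x y : State N) :
    ∑' n, S.jumpProb n t x y = S.jumpProb 0 t x y +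
      ∑ j, ∫⁻ s in Icc 0 t, ENNReal.ofReal (S.a j x * Real.exp (-(S.rate x * s))) *
        ∑' n, S.jumpProb n (t - s) (x + S.ν j) y := by
  rw [tsum_eq_zero_add' ENNReal.summable]
  congr 1
  simp only [jumpProb]
  rw [Summable.tsum_finsetSum fun _ _ => ENNReal.summable]
  refine Finset.sum_congr rfl fun j _ => ?_
  rw [← lintegral_tsum]
  · simp only [ENNReal.tsum_mul_left]
  · intro n
    refine (Measurable.mul (by fun_prop) ?_).aemeasurable
    exact (S.measurable_jumpProb n _ _).comp (by fun_prop)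

variable {S}

/-- Substituting `u = t - s` in the renewal equation moves all dependence on `t` into the
exponential prefactor and the upper limit, where the fundamental theorem of calculus applies. The
clamp `max u 0` gives an integrand controlled on all of `ℝ`, since non-explosivity bounds `P` only
at nonnegative times. -/
theorem NonExplosive.trans_eq (hS : S.NonExplosive) {t : ℝ} (ht : 0 ≤ t) (x y : State N) :
    S.trans t x y = Real.exp (-(S.rate x * t)) * ((if x = y then 1 else 0) +
      ∑ j, ∫ u in (0 : ℝ)..t,
        S.a j x * Real.exp (S.rate x * u) * S.trans (max u 0) (x + S.ν j) y) := by
  have hlt : ∑' n, S.jumpProb n t x y < ∞ :=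
    (hS.tsum_jumpProb_le_one ht x y).trans_lt ENNReal.one_lt_top
  have key := S.tsum_jumpProb_eq t x y
  rw [key] at hlt
  rw [trans, key, ENNReal.toReal_add (ne_top_of_le_ne_top hlt.ne le_self_add)
    (ne_top_of_le_ne_top hlt.ne le_add_self), ENNReal.toReal_sum fun j hj =>
      ne_top_of_le_ne_top hlt.ne ((Finset.single_le_sum
        (f := fun j => ∫⁻ s in Icc 0 t, ENNReal.ofReal (S.a j x * Real.exp (-(S.rate x * s))) *
        ∑' n, S.jumpProb n (t - s) (x + S.ν j) y)
        (fun _ _ => zero_le) hj).trans le_add_self),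
    mul_add, Finset.mul_sum]
  congr 1
  · simp only [jumpProb]
    split_ifs <;> simp [Real.exp_nonneg]
  · refine Finset.sum_congr rfl fun j _ => ?_
    rw [← integral_toReal]
    rotate_left
    · refine (Measurable.mul (by fun_prop) ?_).aemeasurable
      exact (S.measurable_tsum_jumpProb _ _).comp (by fun_prop)
    · refine (ae_restrict_mem measurableSet_Icc).mono fun s hs => ?_
      exact ENNReal.mul_lt_top ENNReal.ofReal_lt_top
        ((hS.tsum_jumpProb_le_one (sub_nonneg.2 hs.2) _ _).trans_lt ENNReal.one_lt_top)
    rw [integral_Icc_eq_integral_Ioc, ← intervalIntegral.integral_of_le ht,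
      ← intervalIntegral.integral_const_mul]
    have h := intervalIntegral.integral_comp_sub_left (a := 0) (b := t) (fun u =>
      Real.exp (-(S.rate x * t)) *
        (S.a j x * Real.exp (S.rate x * u) * S.trans (max u 0) (x + S.ν j) y)) t
    rw [sub_self, sub_zero] at h
    rw [← h]
    refine intervalIntegral.integral_congr fun s hs => ?_
    rw [uIcc_of_le ht] at hs
    simp only [ENNReal.toReal_mul]
    rw [max_eq_left (sub_nonneg.2 hs.2),
      ENNReal.toReal_ofReal (mul_nonneg (S.a_nonneg j x) (Real.exp_nonneg _)), trans]
    have : Real.exp (-(S.rate x * s)) =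
        Real.exp (-(S.rate x * t)) * Real.exp (S.rate x * (t - s)) := by
      rw [← Real.exp_add]; ring_nf
    rw [this]; ring

theorem NonExplosive.intervalIntegrable_trans (hS : S.NonExplosive) (c r a b : ℝ)
    (x y : State N) :
    IntervalIntegrable (fun u => c * Real.exp (r * u) * S.trans (max u 0) x y) volume a b := by
  have h : IntervalIntegrable (fun u => c * Real.exp (r * u)) volume a b :=
    Continuous.intervalIntegrable (by fun_prop) a b
  rw [intervalIntegrable_iff] at h ⊢
  refine h.mul_bdd (c := 1) ?_ ?_
  · exact ((S.measurable_trans x y).comp (by fun_prop)).aestronglyMeasurable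
  · refine Filter.Eventually.of_forall fun u => ?_
    rw [Real.norm_of_nonneg (S.trans_nonneg _ _ _)]
    exact hS.trans_le_one (le_max_right _ _) x y

/-- Bootstrap: a bounded measurable integrand has a continuous primitive, and this continuity in
turn makes the primitive differentiable. -/
theorem NonExplosive.continuous_trans (hS : S.NonExplosive) (x y : State N) :
    Continuous fun t => S.trans (max t 0) x y := by
  have h : Continuous fun t => Real.exp (-(S.rate x * t)) * ((if x = y then 1 else 0) +
      ∑ j, ∫ u in (0 : ℝ)..t,
        S.a j x * Real.exp (S.rate x * u) * S.trans (max u 0) (x + S.ν j) y) := by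
    refine Continuous.mul (by fun_prop) (continuous_const.add ?_)
    exact continuous_finsetSum _ fun j _ => intervalIntegral.continuous_primitive
      (fun a b => hS.intervalIntegrable_trans _ _ a b _ _) 0
  refine (h.comp (continuous_id.max (continuous_const (y := (0 : ℝ))))).congr fun t => ?_
  exact (hS.trans_eq (le_max_right t 0) x y).symm

/-- The Kolmogorov backward equation. -/
theorem NonExplosive.hasDerivWithinAt_trans (hS : S.NonExplosive) {t : ℝ} (ht : 0 ≤ t)
    (x y : State N) :
    HasDerivWithinAt (fun t => S.trans t x y)
      (∑ j, S.a j x * (S.trans t (x + S.ν j) y - S.trans t x y)) (Ici 0) t := by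
  have hexp : HasDerivAt (fun t => Real.exp (-(S.rate x * t)))
      (Real.exp (-(S.rate x * t)) * -(S.rate x)) t := by
    simpa using (((hasDerivAt_id t).const_mul (S.rate x)).neg).exp
  have hint (j : Fin M) : HasDerivAt (fun t => ∫ u in (0 : ℝ)..t,
        S.a j x * Real.exp (S.rate x * u) * S.trans (max u 0) (x + S.ν j) y)
        (S.a j x * Real.exp (S.rate x * t) * S.trans (max t 0) (x + S.ν j) y) t := by
    refine (Continuous.integral_hasStrictDerivAt ?_ 0 t).hasDerivAt
    exact Continuous.mul (by fun_prop) (hS.continuous_trans _ _)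
  have h := hexp.mul ((HasDerivAt.fun_sum fun j (_ : j ∈ Finset.univ) => hint j).const_add
    (if x = y then (1 : ℝ) else 0))
  refine (h.hasDerivWithinAt.congr (fun s hs => hS.trans_eq hs x y)
    (hS.trans_eq ht x y)).congr_deriv ?_
  have h2 : Real.exp (-(S.rate x * t)) * Real.exp (S.rate x * t) = 1 := by
    rw [← Real.exp_add]; simp
  have h3 : ∀ j, Real.exp (-(S.rate x * t)) *
      (S.a j x * Real.exp (S.rate x * t) * S.trans (max t 0) (x + S.ν j) y) =
      S.a j x * S.trans t (x + S.ν j) y := fun j => by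
    rw [max_eq_left ht]
    linear_combination (S.a j x * S.trans t (x + S.ν j) y) * h2
  rw [Finset.mul_sum, Finset.sum_congr rfl fun j _ => h3 j, mul_right_comm,
    ← hS.trans_eq ht x y]
  simp only [mul_sub, Finset.sum_sub_distrib, ← Finset.sum_mul]
  rw [← rate]; ring

/-! ### Time derivatives of `P` as iterates of the generator. -/

variable (S)

/-- The `k`-th iterate of the generator applied to `P(t, ·, y)`. -/
noncomputable def genIter : ℕ → ℝ → State N → State N → ℝ
  | 0, t, x, y => S.trans t x y
  | k + 1, t, x, y => ∑ j, S.a j x * (genIter k t (x + S.ν j) y - genIter k t x y)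

variable {S}

/-- The generator is a finite sum acting on the initial state only, so it commutes with the time
derivative. -/
theorem NonExplosive.hasDerivWithinAt_genIter (hS : S.NonExplosive) (k : ℕ) {t : ℝ}
    (ht : 0 ≤ t) (x y : State N) :
    HasDerivWithinAt (fun t => S.genIter k t x y) (S.genIter (k + 1) t x y) (Ici 0) t := by
  induction k generalizing x with
  | zero => exact hS.hasDerivWithinAt_trans ht x y
  | succ k ih =>
    simp only [genIter] at ih ⊢
    exact HasDerivWithinAt.fun_sum fun j _ => ((ih _).sub (ih _)).const_mul _

theorem NonExplosive.entryDeriv_trans (hS : S.NonExplosive) (k : ℕ) {t : ℝ}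
    (ht : 0 ≤ t) (x y : State N) : entryDeriv k S.trans t x y = S.genIter k t x y := by
  induction k generalizing t with
  | zero => simp [entryDeriv, genIter]
  | succ k ih =>
    rw [entryDeriv, iteratedDerivWithin_succ]
    refine HasDerivWithinAt.derivWithin ?_ (uniqueDiffOn_Ici 0 t ht)
    exact (hS.hasDerivWithinAt_genIter k ht x y).congr (fun s hs => ih hs) (ih ht)

theorem NonExplosive.contDiffOn_trans (hS : S.NonExplosive) (n : ℕ) (x y : State N) :
    ContDiffOn ℝ n (fun t => S.trans t x y) (Ici 0) := by
  refine contDiffOn_of_differentiableOn_deriv fun k _ => ?_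
  intro t ht
  refine ((hS.hasDerivWithinAt_genIter k ht x y).differentiableWithinAt).congr
    (fun s hs => hS.entryDeriv_trans k hs x y) (hS.entryDeriv_trans k ht x y)

/-- The total variation of the iterated generator grows at most polynomially. -/
theorem NonExplosive.exists_tsum_genIter_le (hS : S.NonExplosive)
    (nrm : Seminorm ℝ (Fin N → ℝ)) (h : PolyGrowth nrm S) (k : ℕ) :
    ∃ (K : ℝ) (r : ℕ), 0 < K ∧ ∀ t : ℝ, 0 ≤ t → ∀ x,
      ∑' y, ENNReal.ofReal |S.genIter k t x y| ≤ ENNReal.ofReal (K * (1 + size nrm x) ^ r) := by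
  have h1 (x : State N) : 0 ≤ size nrm x := apply_nonneg nrm _
  induction k with
  | zero =>
    refine ⟨1, 0, one_pos, fun t ht x => ?_⟩
    simp only [genIter, abs_of_nonneg (S.trans_nonneg _ _ _), hS.ofReal_trans ht, hS t ht x]
    simp
  | succ k ih =>
    obtain ⟨K, r, hK, ih⟩ := ih
    obtain ⟨s, hs⟩ := h
    choose α hα ha using hs
    -- The weight `1 + |x|` is submultiplicative under shifts, so a jump costs only a constant
    -- factor.
    have hν : ∀ j (x : State N), (1 + size nrm (x + S.ν j)) ^ r ≤
        (1 + size nrm (S.ν j)) ^ r * (1 + size nrm x) ^ r := fun j x => by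
      rw [← mul_pow]
      refine pow_le_pow_left₀ (by linarith [h1 (x + S.ν j)]) ?_ r
      have : size nrm (x + S.ν j) ≤ size nrm x + size nrm (S.ν j) := by
        refine le_trans (le_of_eq ?_) (map_add_le_add nrm _ _)
        simp only [size]; congr 1; ext i; simp
      nlinarith [mul_nonneg (h1 (S.ν j)) (h1 x)]
    -- The summand `1` keeps the constant positive when there are no reactions.
    refine ⟨∑ j, 2 * α j * (K * ((1 + size nrm (S.ν j)) ^ r + 1)) + 1, s + r, ?_,
      fun t ht x => ?_⟩
    · refine add_pos_of_nonneg_of_pos (Finset.sum_nonneg fun j _ => ?_) one_pos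
      have := h1 (S.ν j); have := hα j
      positivity
    have hx : 1 ≤ 1 + size nrm x := by linarith [h1 x]
    calc ∑' y, ENNReal.ofReal |S.genIter (k + 1) t x y|
        ≤ ∑' y, ∑ j, ENNReal.ofReal (S.a j x) * (ENNReal.ofReal |S.genIter k t (x + S.ν j) y| +
            ENNReal.ofReal |S.genIter k t x y|) := by
          refine ENNReal.tsum_le_tsum fun y => ?_
          rw [genIter]
          have e : ∀ j, ENNReal.ofReal (S.a j x) *
              (ENNReal.ofReal |S.genIter k t (x + S.ν j) y| +
              ENNReal.ofReal |S.genIter k t x y|) = ENNReal.ofReal (S.a j x *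
              (|S.genIter k t (x + S.ν j) y| + |S.genIter k t x y|)) := fun j => by
            rw [ENNReal.ofReal_mul (S.a_nonneg j x),
              ENNReal.ofReal_add (abs_nonneg _) (abs_nonneg _)]
          rw [Finset.sum_congr rfl fun j _ => e j, ← ENNReal.ofReal_sum_of_nonneg fun j _ =>
            mul_nonneg (S.a_nonneg j x) (by positivity)]
          refine ENNReal.ofReal_le_ofReal ((Finset.abs_sum_le_sum_abs _ _).trans ?_)
          refine Finset.sum_le_sum fun j _ => ?_
          rw [abs_mul, abs_of_nonneg (S.a_nonneg j x)]
          exact mul_le_mul_of_nonneg_left (abs_sub _ _) (S.a_nonneg j x)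
      _ = ∑ j, ENNReal.ofReal (S.a j x) * (∑' y, ENNReal.ofReal |S.genIter k t (x + S.ν j) y| +
            ∑' y, ENNReal.ofReal |S.genIter k t x y|) := by
          rw [Summable.tsum_finsetSum fun _ _ => ENNReal.summable]
          simp only [ENNReal.tsum_mul_left, ENNReal.tsum_add]
      _ ≤ ∑ j, ENNReal.ofReal (2 * α j * (K * ((1 + size nrm (S.ν j)) ^ r + 1)) *
            (1 + size nrm x) ^ (s + r)) := by
          refine Finset.sum_le_sum fun j _ => ?_
          have ha' : S.a j x ≤ 2 * α j * (1 + size nrm x) ^ s := by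
            have e1 : size nrm x ^ s ≤ (1 + size nrm x) ^ s :=
              pow_le_pow_left₀ (h1 x) (by linarith) s
            have e2 : 1 ≤ (1 + size nrm x) ^ s := one_le_pow₀ hx
            have := (le_abs_self _).trans (ha j x)
            nlinarith [hα j]
          have hp : 0 ≤ (1 + size nrm x) ^ r := by positivity
          calc _ ≤ ENNReal.ofReal (2 * α j * (1 + size nrm x) ^ s) *
                (ENNReal.ofReal (K * ((1 + size nrm (S.ν j)) ^ r * (1 + size nrm x) ^ r)) +
                  ENNReal.ofReal (K * (1 + size nrm x) ^ r)) := by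
                refine mul_le_mul' (ENNReal.ofReal_le_ofReal ha') (add_le_add ?_ (ih t ht x))
                refine (ih t ht _).trans (ENNReal.ofReal_le_ofReal ?_)
                exact mul_le_mul_of_nonneg_left (hν j x) hK.le
            _ = _ := by
                have := h1 (S.ν j); have := hα j
                rw [← ENNReal.ofReal_add (by positivity) (by positivity),
                  ← ENNReal.ofReal_mul (by positivity)]
                congr 1; ring
      _ ≤ _ := by
          rw [← ENNReal.ofReal_sum_of_nonneg]
          · refine ENNReal.ofReal_le_ofReal ?_
            rw [← Finset.sum_mul]
            exact mul_le_mul_of_nonneg_right (by linarith) (by positivity)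
          · intro j _
            have := h1 (S.ν j); have := hα j
            positivity

end ChemicalSystem

end TauLeap

namespace TauLeap

open MeasureTheory Set

/-! ### Moment variations and the action of matrices. -/

section Variation

variable {N : ℕ} (nrm : Seminorm ℝ (Fin N → ℝ))

theorem size_nonneg (x : State N) : 0 ≤ size nrm x := apply_nonneg nrm _

theorem momVar_zero (g : State N → ℝ) : momVar nrm 0 g = ∑' x, ENNReal.ofReal |g x| := by
  simp only [momVar, pow_zero]
  norm_num

theorem momVar_zero_add_le (g h : State N → ℝ) :
    momVar nrm 0 (fun x => g x + h x) ≤ momVar nrm 0 g + momVar nrm 0 h := by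
  simp only [momVar_zero, ← Real.enorm_eq_ofReal_abs]
  rw [← ENNReal.tsum_add]
  exact ENNReal.tsum_le_tsum fun x => enorm_add_le _ _

theorem momVar_eq_tsum_mul (r : ℕ) (g : State N → ℝ) :
    momVar nrm r g =
      ∑' x, ENNReal.ofReal ((1 + size nrm x ^ r) / 2) * ENNReal.ofReal |g x| := by
  refine tsum_congr fun x => ENNReal.ofReal_mul ?_
  have := size_nonneg nrm x
  positivity

/-- Triangle inequality and Tonelli. No summability is needed: a divergent series in `act` has the
value `0`. -/
theorem momVar_act_le (r : ℕ) (ψ : State N → State N → ℝ) (g : State N → ℝ) :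
    momVar nrm r (act ψ g) ≤ ∑' x, (∑' y, ENNReal.ofReal ((1 + size nrm y ^ r) / 2) *
      ENNReal.ofReal |ψ x y|) * ENNReal.ofReal |g x| := by
  rw [momVar_eq_tsum_mul]
  calc _ ≤ ∑' y, ∑' x, ENNReal.ofReal ((1 + size nrm y ^ r) / 2) *
        ENNReal.ofReal |ψ x y| * ENNReal.ofReal |g x| := by
        refine ENNReal.tsum_le_tsum fun y => ?_
        simp only [mul_assoc, ENNReal.tsum_mul_left]
        refine mul_le_mul_right ?_ _
        simp only [← Real.enorm_eq_ofReal_abs, ← enorm_mul, act]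
        exact enorm_tsum_le_tsum_enorm
    _ = _ := by
        rw [ENNReal.tsum_comm]
        simp only [ENNReal.tsum_mul_right]

theorem momVar_zero_act_le (ψ : State N → State N → ℝ) (g : State N → ℝ) :
    momVar nrm 0 (act ψ g) ≤
      ∑' x, (∑' y, ENNReal.ofReal |ψ x y|) * ENNReal.ofReal |g x| := by
  have h : ENNReal.ofReal ((1 + 1) / 2) = 1 := by norm_num
  simpa [h] using momVar_act_le nrm 0 ψ g

end Variation

/-! ### One-step consistency in total variation. -/

section Consistency

/-- Taylor's formula with zero initial data, in `ℓ¹`: each of the `k` integrations from `0` lowers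
the order of the derivative by one and gains a factor `t`, with Tonelli exchanging sum and integral.
-/
theorem tsum_ofReal_abs_le_of_deriv {ι : Type*} [Countable ι] {D : ℕ → ℝ → ι → ℝ} {q : ℕ}
    {B γ δ : ℝ} (hB : 0 ≤ B) (hγ : 0 ≤ γ)
    (hD : ∀ k ≤ q, ∀ t, 0 ≤ t → ∀ y,
      HasDerivWithinAt (fun t => D k t y) (D (k + 1) t y) (Ici 0) t)
    (hcont : ∀ y, ContinuousOn (fun t => D (q + 1) t y) (Ici 0))
    (h0 : ∀ k ≤ q, ∀ y, D k 0 y = 0)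
    (hb : ∀ t ∈ Ioo 0 δ, ∑' y, ENNReal.ofReal |D (q + 1) t y| ≤
      ENNReal.ofReal (B * Real.exp (γ * t)))
    (k : ℕ) (hk : k ≤ q + 1) (t : ℝ) (ht : t ∈ Ioo 0 δ) :
    ∑' y, ENNReal.ofReal |D (q + 1 - k) t y| ≤ ENNReal.ofReal (B * Real.exp (γ * t) * t ^ k) := by
  induction k generalizing t with
  | zero => simpa using hb t ht
  | succ k ih =>
    have hk' : k ≤ q := by omega
    set m := q + 1 - (k + 1) with hm
    have hmq : m ≤ q := by omega
    have hm1 : q + 1 - k = m + 1 := by omega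
    rw [hm1] at ih
    have hc : ∀ y, ContinuousOn (fun t => D (m + 1) t y) (Ici 0) := by
      intro y
      rcases hmq.eq_or_lt with h | h
      · rw [h]; exact hcont y
      · exact fun s hs => (hD (m + 1) h s hs y).continuousWithinAt
    have hle : ∀ y, ENNReal.ofReal |D m t y| ≤
        ∫⁻ s in Ioc 0 t, ENNReal.ofReal |D (m + 1) s y| := by
      intro y
      have hint : ∫ s in (0 : ℝ)..t, D (m + 1) s y = D m t y - D m 0 y := by
        refine intervalIntegral.integral_eq_sub_of_hasDerivAt_of_le (f := fun t => D m t y)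
          ht.1.le ?_ ?_ ?_
        · exact fun s hs => ((hD m hmq s hs.1 y).continuousWithinAt).mono Icc_subset_Ici_self
        · exact fun s hs => (hD m hmq s hs.1.le y).hasDerivAt (Ici_mem_nhds hs.1)
        · refine ContinuousOn.intervalIntegrable ((hc y).mono ?_)
          rw [uIcc_of_le ht.1.le]
          exact Icc_subset_Ici_self
      rw [h0 m hmq, sub_zero, intervalIntegral.integral_of_le ht.1.le] at hint
      rw [← hint]
      simp only [← Real.enorm_eq_ofReal_abs]
      exact enorm_integral_le_lintegral_enorm _
    calc ∑' y, ENNReal.ofReal |D m t y|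
        ≤ ∑' y, ∫⁻ s in Ioc 0 t, ENNReal.ofReal |D (m + 1) s y| := ENNReal.tsum_le_tsum hle
      _ = ∫⁻ s in Ioc 0 t, ∑' y, ENNReal.ofReal |D (m + 1) s y| := by
          refine (lintegral_tsum fun y => ?_).symm
          refine ENNReal.measurable_ofReal.comp_aemeasurable ?_
          exact (((hc y).mono (Ioc_subset_Icc_self.trans Icc_subset_Ici_self)).abs).aemeasurable
            measurableSet_Ioc
      -- The integrand is bounded by the value of its increasing majorant at `t`; this forgoes the
      -- factorial but leaves the exponential intact.
      _ ≤ ∫⁻ _ in Ioc 0 t, ENNReal.ofReal (B * Real.exp (γ * t) * t ^ k) := by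
          refine setLIntegral_mono measurable_const fun s hs => ?_
          refine (ih (by omega) s ⟨hs.1, hs.2.trans_lt ht.2⟩).trans (ENNReal.ofReal_le_ofReal ?_)
          have h1 := hs.1.le
          have h2 := hs.2
          gcongr
      _ = _ := by
          have := ht.1.le
          rw [setLIntegral_const, Real.volume_Ioc, ← ENNReal.ofReal_mul (by positivity), sub_zero,
            pow_succ, ← mul_assoc]

variable {N M : ℕ} (nrm : Seminorm ℝ (Fin N → ℝ)) {S : ChemicalSystem N M}
  {φ : ℝ → State N → State N → ℝ} {q : ℕ}

theorem hasDerivWithinAt_entryDeriv {n k : ℕ} {x y : State N}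
    (h : ContDiffOn ℝ n (fun τ => φ τ x y) (Ici 0)) (hk : k < n) {t : ℝ} (ht : 0 ≤ t) :
    HasDerivWithinAt (fun t => entryDeriv k φ t x y) (entryDeriv (k + 1) φ t x y) (Ici 0) t := by
  have h1 := h.differentiableOn_iteratedDerivWithin (m := k) (by exact_mod_cast hk)
    (uniqueDiffOn_Ici 0) t ht
  have h2 := h1.hasDerivWithinAt
  rwa [← iteratedDerivWithin_succ] at h2

theorem tsum_ofReal_abs_sub_trans_le (hS : S.NonExplosive) (h3 : PointwiseConsistent S φ q)
    {H γ δ : ℝ} {s : ℕ} (hH : 0 < H) (hγ : 0 < γ)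
    (hφ : TVDerivBound nrm φ (q + 1) (Ico 0 δ) H s γ)
    (hP : TVDerivBound nrm S.trans (q + 1) (Ioi 0) H s γ) {t : ℝ} (ht : t ∈ Ico 0 δ)
    (x : State N) :
    ∑' y, ENNReal.ofReal |φ t x y - S.trans t x y| ≤
      ENNReal.ofReal (H * (size nrm x ^ s + 1) * Real.exp (γ * t) * t ^ (q + 1)) := by
  have hx := size_nonneg nrm x
  rcases ht.1.eq_or_lt with rfl | h0
  -- The Taylor estimate lives on the open interval, as the bound on `P` is for positive times; at
  -- `0` the two kernels agree.
  · have h : ∀ y, φ 0 x y = S.trans 0 x y := fun y => by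
      simpa [entryDeriv] using (h3 x y).2 0 (Nat.zero_le q)
    simp [h]
  have key := tsum_ofReal_abs_le_of_deriv
    (D := fun k t y => entryDeriv k φ t x y - entryDeriv k S.trans t x y)
    (q := q) (B := H * (size nrm x ^ s + 1)) (γ := γ) (δ := δ) (by positivity) hγ.le
    ?_ ?_ ?_ ?_ (q + 1) le_rfl t ⟨h0, ht.2⟩
  · simpa [entryDeriv] using key
  · intro k hk t ht y
    exact (hasDerivWithinAt_entryDeriv (h3 x y).1 (by omega) ht).sub
      (hasDerivWithinAt_entryDeriv (hS.contDiffOn_trans (q + 1) x y) (by omega) ht)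
  · intro y
    exact ((h3 x y).1.continuousOn_iteratedDerivWithin le_rfl (uniqueDiffOn_Ici 0)).sub
      ((hS.contDiffOn_trans (q + 1) x y).continuousOn_iteratedDerivWithin le_rfl
        (uniqueDiffOn_Ici 0))
  · intro k hk y
    exact sub_eq_zero.2 ((h3 x y).2 k hk)
  · intro u hu
    calc _ ≤ ∑' y, (ENNReal.ofReal |entryDeriv (q + 1) φ u x y| +
          ENNReal.ofReal |entryDeriv (q + 1) S.trans u x y|) := by
          refine ENNReal.tsum_le_tsum fun y => ?_
          rw [← ENNReal.ofReal_add (abs_nonneg _) (abs_nonneg _)]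
          exact ENNReal.ofReal_le_ofReal (abs_sub _ _)
      _ ≤ _ := by
          rw [ENNReal.tsum_add]
          refine (add_le_add (hφ u ⟨hu.1.le, hu.2⟩ x) (hP u hu.1 x)).trans ?_
          rw [← ENNReal.ofReal_add (by positivity) (by positivity)]
          refine ENNReal.ofReal_le_ofReal (le_of_eq ?_)
          ring

theorem tvConsistent_of_tvDerivBound (hS : S.NonExplosive) (h3 : PointwiseConsistent S φ q)
    {H γ δ : ℝ} {s : ℕ} (hH : 0 < H) (hγ : 0 < γ)
    (hφ : TVDerivBound nrm φ (q + 1) (Ico 0 δ) H s γ)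
    (hP : TVDerivBound nrm S.trans (q + 1) (Ioi 0) H s γ) :
    TVConsistent nrm S φ q (2 * H) s δ γ := by
  intro t ht g _
  refine (momVar_zero_act_le nrm _ g).trans ?_
  rw [momVar_eq_tsum_mul, mul_right_comm, ← ENNReal.tsum_mul_left]
  refine ENNReal.tsum_le_tsum fun x => ?_
  rw [← mul_assoc]
  refine mul_le_mul_left ?_ _
  have hx := size_nonneg nrm x
  have ht0 := ht.1
  rw [← ENNReal.ofReal_mul (by positivity), ← ENNReal.ofReal_mul (by positivity)]
  refine (tsum_ofReal_abs_sub_trans_le nrm hS h3 hH hγ hφ hP ht x).trans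
    (ENNReal.ofReal_le_ofReal (le_of_eq ?_))
  ring

/-- Raising the exponent costs a factor `2`, because `|x|^s` may exceed `|x|^s'` when `|x| < 1`. -/
theorem TVDerivBound.mono {ψ : ℝ → State N → State N → ℝ} {k : ℕ} {I : Set ℝ} {H H' : ℝ}
    {s s' : ℕ} {γ γ' : ℝ} (h : TVDerivBound nrm ψ k I H s γ) (hI : ∀ t ∈ I, 0 ≤ t) (hH : 0 ≤ H)
    (hHH : 2 * H ≤ H') (hs : s ≤ s') (hγ : γ ≤ γ') : TVDerivBound nrm ψ k I H' s' γ' := by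
  intro t ht x
  refine (h t ht x).trans (ENNReal.ofReal_le_ofReal ?_)
  have hx := size_nonneg nrm x
  have ht0 := hI t ht
  have h1 : size nrm x ^ s + 1 ≤ 2 * (size nrm x ^ s' + 1) := by
    rcases le_total (size nrm x) 1 with h | h
    · have := pow_le_one₀ (n := s) hx h
      have : 0 ≤ size nrm x ^ s' := by positivity
      linarith
    · have := pow_le_pow_right₀ h hs
      linarith [one_le_pow₀ (n := s') h]
  calc H / 2 * (size nrm x ^ s + 1) * Real.exp (γ * t)
      ≤ H / 2 * (2 * (size nrm x ^ s' + 1)) * Real.exp (γ' * t) := by gcongr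
    _ = 2 * H / 2 * (size nrm x ^ s' + 1) * Real.exp (γ' * t) := by ring
    _ ≤ _ := by gcongr

theorem exists_tvDerivBound_trans (hS : S.NonExplosive) (h : PolyGrowth nrm S) (k : ℕ) :
    ∃ (H : ℝ) (s : ℕ), 0 < H ∧ TVDerivBound nrm S.trans k (Ioi 0) H s 0 := by
  obtain ⟨K, r, hK, hb⟩ := hS.exists_tsum_genIter_le nrm h k
  refine ⟨2 * (K * 2 ^ r), r, by positivity, fun t ht x => ?_⟩
  simp only [hS.entryDeriv_trans k (le_of_lt ht)]
  refine (hb t (le_of_lt ht) x).trans (ENNReal.ofReal_le_ofReal ?_)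
  have hx := size_nonneg nrm x
  have h1 : (1 + size nrm x) ^ r ≤ 2 ^ r * (size nrm x ^ r + 1) := by
    rcases le_total (size nrm x) 1 with h | h
    · have h2 : (1 + size nrm x) ^ r ≤ 2 ^ r := pow_le_pow_left₀ (by linarith) (by linarith) r
      have h3 : 0 ≤ (2 : ℝ) ^ r * size nrm x ^ r := by positivity
      linarith
    · have h2 : (1 + size nrm x) ^ r ≤ (2 * size nrm x) ^ r :=
        pow_le_pow_left₀ (by linarith) (by linarith) r
      rw [mul_pow] at h2
      have h3 : 0 < (2 : ℝ) ^ r := by positivity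
      linarith
  rw [zero_mul, Real.exp_zero, mul_one]
  nlinarith

end Consistency

/-! ### Propagation of laws and accumulation of the error. -/

section Convergence

variable {N M : ℕ} (nrm : Seminorm ℝ (Fin N → ℝ)) {S : ChemicalSystem N M}
  {φ : ℝ → State N → State N → ℝ} {q : ℕ}
variable {Ω : Type*} [MeasurableSpace Ω] {ℙ : Measure Ω}

theorem hasSum_law_inter [IsFiniteMeasure ℙ] {Z : Ω → State N} (hZ : Measurable Z) {B : Set Ω}
    (hB : MeasurableSet B) : HasSum (fun x => ℙ.real ({ω | Z ω = x} ∩ B)) (ℙ.real B) := by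
  have hU : B = ⋃ x, {ω | Z ω = x} ∩ B := by ext; simp
  have h : ℙ B = ∑' x, ℙ ({ω | Z ω = x} ∩ B) := by
    conv_lhs => rw [hU]
    refine measure_iUnion (fun x y hxy => ?_) fun x => (hZ (measurableSet_singleton x)).inter hB
    refine Disjoint.inter_left _ (Disjoint.inter_right _ ?_)
    rw [Set.disjoint_left]
    rintro ω rfl h
    exact hxy h
  have h2 := (ENNReal.summable_toReal (h ▸ measure_ne_top ℙ B)).hasSum
  rwa [← ENNReal.tsum_toReal_eq fun x => measure_ne_top _ _, ← h] at h2

theorem summable_law [IsFiniteMeasure ℙ] {Z : Ω → State N} (hZ : Measurable Z) :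
    Summable (law ℙ Z) := by
  have h := (hasSum_law_inter (ℙ := ℙ) hZ MeasurableSet.univ).summable
  simp only [inter_univ] at h
  exact h

/-- The law of total probability over the countably many values of `Z`. -/
theorem law_eq_act [IsFiniteMeasure ℙ] {Z Z' : Ω → State N} (hZ : Measurable Z)
    (hZ' : Measurable Z') {ψ : State N → State N → ℝ}
    (h : ∀ x y, ℙ.real ({ω | Z ω = x} ∩ {ω | Z' ω = y}) = ℙ.real {ω | Z ω = x} * ψ x y) :
    law ℙ Z' = act ψ (law ℙ Z) := by
  funext y
  refine (hasSum_law_inter (ℙ := ℙ) hZ (hZ' (measurableSet_singleton y))).tsum_eq.symm.trans ?_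
  rw [act]
  refine tsum_congr fun x => ?_
  rw [mul_comm, law, ← h]
  rfl

theorem IsChemicalProcess.law_add [IsFiniteMeasure ℙ] {p₀ : PMF (State N)}
    {X : ℝ≥0 → Ω → State N} (hX : IsChemicalProcess S p₀ ℙ X) (s t : ℝ≥0) :
    law ℙ (X (s + t)) = act (S.trans t) (law ℙ (X s)) :=
  law_eq_act (hX.measurable s) (hX.measurable _) fun x y => by
    simpa using hX.markov s t univ MeasurableSet.univ x y

theorem IsChemicalProcess.law_zero {p₀ : PMF (State N)}
    {X : ℝ≥0 → Ω → State N} (hX : IsChemicalProcess S p₀ ℙ X) :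
    law ℙ (X 0) = fun x => (p₀ x).toReal := by
  funext x
  rw [law, Measure.real, hX.initial]

theorem momVar_act_trans_le {lam : ℕ → ℝ} (h2 : ExpMomentGrowth nrm S lam) (r : ℕ) {t : ℝ}
    (ht : 0 < t) (g : State N → ℝ) :
    momVar nrm r (act (S.trans t) g) ≤ ENNReal.ofReal (Real.exp (lam r * t)) * momVar nrm r g := by
  refine (momVar_act_le nrm r _ g).trans ?_
  rw [momVar_eq_tsum_mul, ← ENNReal.tsum_mul_left]
  refine ENNReal.tsum_le_tsum fun x => ?_
  rw [← mul_assoc]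
  refine mul_le_mul_left ?_ _
  have h := (h2 r).2 t ht x
  have h1 (x : State N) := size_nonneg nrm x
  have e (y : State N) : ENNReal.ofReal ((1 + size nrm y ^ r) / 2) *
      ENNReal.ofReal |S.trans t x y| =
      ENNReal.ofReal (1 / 2) * ENNReal.ofReal ((1 + size nrm y ^ r) * S.trans t x y) := by
    have := h1 y
    rw [abs_of_nonneg (S.trans_nonneg _ _ _), ← ENNReal.ofReal_mul (by positivity),
      ← ENNReal.ofReal_mul (by positivity)]
    congr 1; ring
  simp only [e, ENNReal.tsum_mul_left]
  refine (mul_le_mul_right h _).trans (le_of_eq ?_)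
  have := h1 x
  rw [← ENNReal.ofReal_mul (by positivity), ← ENNReal.ofReal_mul (by positivity)]
  congr 1; ring

theorem IsChemicalProcess.momVar_law_le [IsFiniteMeasure ℙ] {p₀ : PMF (State N)}
    {X : ℝ≥0 → Ω → State N} (hX : IsChemicalProcess S p₀ ℙ X) {lam : ℕ → ℝ}
    (h2 : ExpMomentGrowth nrm S lam) (r : ℕ) (t : ℝ≥0) :
    momVar nrm r (law ℙ (X t)) ≤
      ENNReal.ofReal (Real.exp (lam r * t)) * momVar nrm r (fun x => (p₀ x).toReal) := by
  rcases eq_or_ne t 0 with rfl | ht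
  · simp [hX.law_zero]
  · have h := hX.law_add 0 t
    rw [zero_add, hX.law_zero] at h
    rw [h]
    exact momVar_act_trans_le nrm h2 r (by exact_mod_cast pos_iff_ne_zero.2 ht) _

theorem IsTauLeapSolution.law_succ [IsFiniteMeasure ℙ] {p₀ : PMF (State N)} {T : ℝ≥0} {n : ℕ}
    {m : Mesh T n} {Y : ℝ≥0 → Ω → State N} (hY : IsTauLeapSolution φ m p₀ ℙ Y) (j : Fin n) :
    law ℙ (Y (m.t j.succ)) = act (φ (m.step j)) (law ℙ (Y (m.t j.castSucc))) := by
  have hT (i : Fin (n + 1)) : m.t i ≤ T :=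
    (m.strictMono.monotone (Fin.le_last i)).trans_eq m.t_last
  exact law_eq_act (hY.measurable _ (hT _)) (hY.measurable _ (hT _)) fun x y => by
    simpa using hY.markov j univ MeasurableSet.univ x y

/-- Stability with constant `1`: the rows of `φ t` are probability vectors, so old errors are never
amplified. -/
theorem IsTauLeapMethod.momVar_act_le (hφ : IsTauLeapMethod φ) {t : ℝ} (ht : 0 ≤ t)
    (g : State N → ℝ) : momVar nrm 0 (act (φ t) g) ≤ momVar nrm 0 g := by
  refine (momVar_zero_act_le nrm _ g).trans (le_of_eq ?_)
  rw [momVar_zero]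
  refine tsum_congr fun x => ?_
  have h : ∑' y, ENNReal.ofReal |φ t x y| = 1 := by
    simp only [abs_of_nonneg (hφ.nonneg t ht x _)]
    rw [← ENNReal.ofReal_tsum_of_nonneg (hφ.nonneg t ht x) (hφ.hasSum_one t ht x).summable,
      (hφ.hasSum_one t ht x).tsum_eq, ENNReal.ofReal_one]
  rw [h, one_mul]

theorem IsTauLeapMethod.le_one (hφ : IsTauLeapMethod φ) {t : ℝ} (ht : 0 ≤ t) (x y : State N) :
    φ t x y ≤ 1 :=
  le_hasSum (hφ.hasSum_one t ht x) y fun z _ => hφ.nonneg t ht x z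

theorem summable_mul_of_mem_Icc {ι : Type*} {f g : ι → ℝ} (hf : ∀ i, f i ∈ Icc 0 1)
    (hg : Summable g) : Summable fun i => f i * g i := by
  refine Summable.of_norm_bounded hg.abs fun i => ?_
  rw [norm_mul, Real.norm_of_nonneg (hf i).1]
  exact mul_le_of_le_one_left (abs_nonneg _) (hf i).2

/-- In this splitting the defect `φ - P` meets `h`, later the exact law, whose moments are
controlled; `φ` meets only the difference, where total variation suffices. -/
theorem act_sub_act (hS : S.NonExplosive) (hφ : IsTauLeapMethod φ) {t : ℝ} (ht : 0 ≤ t)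
    {g h : State N → ℝ} (hg : Summable g) (hh : Summable h) (y : State N) :
    act (φ t) g y - act (S.trans t) h y =
      act (φ t) (fun x => g x - h x) y + act (fun x y => φ t x y - S.trans t x y) h y := by
  have h1 (x : State N) : φ t x y ∈ Icc (0 : ℝ) 1 := ⟨hφ.nonneg t ht x y, hφ.le_one ht x y⟩
  have h2 (x : State N) : S.trans t x y ∈ Icc (0 : ℝ) 1 :=
    ⟨S.trans_nonneg t x y, hS.trans_le_one ht x y⟩
  simp only [act, mul_sub, sub_mul]
  rw [(summable_mul_of_mem_Icc h1 hg).tsum_sub (summable_mul_of_mem_Icc h1 hh),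
    (summable_mul_of_mem_Icc h1 hh).tsum_sub (summable_mul_of_mem_Icc h2 hh)]
  ring

theorem Mesh.step_nonneg {T : ℝ≥0} {n : ℕ} (m : Mesh T n) (j : Fin n) : 0 ≤ m.step j :=
  sub_nonneg.2 (by exact_mod_cast m.strictMono.monotone (Fin.castSucc_lt_succ (i := j)).le)

theorem Mesh.step_le_size {T : ℝ≥0} {n : ℕ} (m : Mesh T n) (j : Fin n) : m.step j ≤ m.size :=
  le_ciSup (Set.finite_range m.step).bddAbove j

theorem Mesh.size_nonneg {T : ℝ≥0} {n : ℕ} (m : Mesh T n) : 0 ≤ m.size :=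
  Real.iSup_nonneg m.step_nonneg

theorem momVar_law_sub_law_le (hS : S.NonExplosive) (hφ : IsTauLeapMethod φ)
    {lam : ℕ → ℝ} (h2 : ExpMomentGrowth nrm S lam) {C δ γ : ℝ} {s : ℕ}
    (hC : TVConsistent nrm S φ q C s δ γ) {T : ℝ≥0} {n : ℕ} (m : Mesh T n) (hm : m.size < δ)
    {p₀ : PMF (State N)} (hp₀ : InM nrm (fun x => (p₀ x).toReal))
    {Ω' : Type*} [MeasurableSpace Ω'] {ℙ' : Measure Ω'} [IsFiniteMeasure ℙ] [IsFiniteMeasure ℙ']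
    {X : ℝ≥0 → Ω → State N} {Y : ℝ≥0 → Ω' → State N}
    (hX : IsChemicalProcess S p₀ ℙ X) (hY : IsTauLeapSolution φ m p₀ ℙ' Y) (i : Fin (n + 1)) :
    momVar nrm 0 (fun x => law ℙ' (Y (m.t i)) x - law ℙ (X (m.t i)) x) ≤
      ENNReal.ofReal C * momVar nrm s (fun x => (p₀ x).toReal) *
        ENNReal.ofReal ((m.t i : ℝ) * Real.exp (max (lam s) γ * (m.t i : ℝ)) * m.size ^ q) := by
  have hsz := m.size_nonneg
  induction i using Fin.induction with
  | zero =>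
    have h : law ℙ' (Y 0) = law ℙ (X 0) := by
      rw [hX.law_zero]; funext x; rw [law, Measure.real, hY.initial]
    simp [m.t_zero, h, momVar_zero]
  | succ j ih =>
    have hτ := m.step_nonneg j
    have hτ' := m.step_le_size j
    have hstep : (m.t j.succ : ℝ) = m.t j.castSucc + m.step j := by simp [Mesh.step]
    have hXs : law ℙ (X (m.t j.succ)) = act (S.trans (m.step j)) (law ℙ (X (m.t j.castSucc))) := by
      have h := hX.law_add (m.t j.castSucc) ⟨m.step j, hτ⟩
      have e : m.t j.castSucc + ⟨m.step j, hτ⟩ = m.t j.succ := NNReal.coe_injective hstep.symm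
      rwa [e] at h
    -- The one-step estimate is available on `𝓜` only, so moments of every order are propagated, not
    -- just order `s`.
    have hin : InM nrm (law ℙ (X (m.t j.castSucc))) := fun r =>
      (hX.momVar_law_le nrm h2 r _).trans_lt (ENNReal.mul_lt_top ENNReal.ofReal_lt_top (hp₀ r))
    have hT (i : Fin (n + 1)) : m.t i ≤ T :=
      (m.strictMono.monotone (Fin.le_last i)).trans_eq m.t_last
    set t := m.t j.castSucc with ht
    set τ := m.step j with hτdef
    set μ := max (lam s) γ
    set V := momVar nrm s (fun x => (p₀ x).toReal)
    rw [hstep]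
    have hYs := hY.law_succ j
    rw [← ht, ← hτdef] at hYs
    simp only [hYs, hXs, act_sub_act hS hφ hτ
      (summable_law (ℙ := ℙ') (hY.measurable t (hT j.castSucc)))
      (summable_law (ℙ := ℙ) (hX.measurable t))]
    calc _ ≤ _ := momVar_zero_add_le nrm _ _
      _ ≤ ENNReal.ofReal C * V * ENNReal.ofReal (t * Real.exp (μ * t) * m.size ^ q) +
          ENNReal.ofReal C * (ENNReal.ofReal (Real.exp (lam s * t)) * V) *
            ENNReal.ofReal (τ ^ (q + 1) * Real.exp (γ * τ)) := by
          refine add_le_add ((hφ.momVar_act_le nrm hτ _).trans ih) ?_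
          refine (hC τ ⟨hτ, hτ'.trans_lt hm⟩ _ hin).trans ?_
          gcongr
          exact hX.momVar_law_le nrm h2 s _
      _ = ENNReal.ofReal C * V * (ENNReal.ofReal (t * Real.exp (μ * t) * m.size ^ q) +
            ENNReal.ofReal (Real.exp (lam s * t)) *
              ENNReal.ofReal (τ ^ (q + 1) * Real.exp (γ * τ))) := by ring
      _ ≤ _ := by
          have ht0 : (0 : ℝ) ≤ t := t.coe_nonneg
          have hμ : 0 ≤ μ := (h2 s).1.le.trans (le_max_left _ _)
          rw [← ENNReal.ofReal_mul (by positivity), ← ENNReal.ofReal_add (by positivity)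
            (by positivity)]
          refine mul_le_mul_right (ENNReal.ofReal_le_ofReal ?_) _
          -- One factor of `τ ^ (q + 1)` is kept and the others are bounded by the mesh size; both
          -- exponential rates rise to `μ`. The two terms then share a common factor, with
          -- coefficients `t` and `τ` adding up to the new time.
          calc _ ≤ t * Real.exp (μ * (t + τ)) * m.size ^ q +
                Real.exp (μ * t) * ((m.size ^ q * τ) * Real.exp (μ * τ)) := by
                rw [pow_succ]
                gcongr
                · linarith
                · exact le_max_left _ _
                · exact le_max_right _ _
            _ = _ := by rw [mul_add μ, Real.exp_add]; ring

end Convergence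

end TauLeap

open TauLeap in
theorem mainTheorem2 {N M : ℕ} (nrm : Seminorm ℝ (Fin N → ℝ)) (hnrm : ∀ v, nrm v = 0 → v = 0)
    (S : ChemicalSystem N M) (hS : S.NonExplosive)
    (φ : ℝ → State N → State N → ℝ) (hφ : IsTauLeapMethod φ) (q : ℕ)
    (h1 : PolyGrowth nrm S)
    (lam : ℕ → ℝ) (h2 : ExpMomentGrowth nrm S lam)
    (h3 : PointwiseConsistent S φ q)
    (H₁ : ℝ) (s₁ : ℕ) (δ₀ γ₁ : ℝ) (hH₁ : 0 < H₁) (hs₁ : 0 < s₁) (hδ₀ : 0 < δ₀) (hγ₁ : 0 < γ₁)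
    (h4 : TVDerivBound nrm φ (q + 1) (Set.Ico 0 δ₀) H₁ s₁ γ₁) :
    (∃ (H₀ : ℝ) (s₀ : ℕ) (γ₀ : ℝ), H₁ ≤ H₀ ∧ s₁ ≤ s₀ ∧ γ₁ ≤ γ₀ ∧
      TVDerivBound nrm φ (q + 1) (Set.Ico 0 δ₀) H₀ s₀ γ₀ ∧
      TVDerivBound nrm S.trans (q + 1) (Set.Ioi 0) H₀ s₀ γ₀) ∧
    ∀ (H₀ : ℝ) (s₀ : ℕ) (γ₀ : ℝ), 0 < H₀ → 0 < s₀ → 0 < γ₀ →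
      TVDerivBound nrm φ (q + 1) (Set.Ico 0 δ₀) H₀ s₀ γ₀ →
      TVDerivBound nrm S.trans (q + 1) (Set.Ioi 0) H₀ s₀ γ₀ →
      (∃ C₀ : ℝ, 0 < C₀ ∧ TVConsistent nrm S φ q C₀ s₀ δ₀ γ₀) ∧
      ∀ C₀ : ℝ, 0 < C₀ → TVConsistent nrm S φ q C₀ s₀ δ₀ γ₀ →
        ∀ (T : ℝ≥0) (n : ℕ) (m : Mesh T n), m.size < δ₀ →
        ∀ p₀ : PMF (State N), InM nrm (fun x => (p₀ x).toReal) →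
        ∀ (Ω Ω' : Type*) [MeasurableSpace Ω] [MeasurableSpace Ω']
          (ℙ : MeasureTheory.Measure Ω) (ℙ' : MeasureTheory.Measure Ω')
          [MeasureTheory.IsProbabilityMeasure ℙ] [MeasureTheory.IsProbabilityMeasure ℙ']
          (X : ℝ≥0 → Ω → State N) (Y : ℝ≥0 → Ω' → State N),
          IsChemicalProcess S p₀ ℙ X → IsTauLeapSolution φ m p₀ ℙ' Y →
          ∀ i : Fin (n + 1),
            momVar nrm 0 (fun x => law ℙ' (Y (m.t i)) x - law ℙ (X (m.t i)) x) ≤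
              ENNReal.ofReal C₀ * momVar nrm s₀ (fun x => (p₀ x).toReal) *
                ENNReal.ofReal
                  ((m.t i : ℝ) * Real.exp (max (lam s₀) γ₀ * (m.t i : ℝ)) * m.size ^ q) ∧
            ENNReal.ofReal C₀ * momVar nrm s₀ (fun x => (p₀ x).toReal) *
                ENNReal.ofReal
                  ((m.t i : ℝ) * Real.exp (max (lam s₀) γ₀ * (m.t i : ℝ)) * m.size ^ q) ≤
              ENNReal.ofReal C₀ * momVar nrm s₀ (fun x => (p₀ x).toReal) *
                ENNReal.ofReal
                  ((T : ℝ) * Real.exp (max (lam s₀) γ₀ * (T : ℝ)) * m.size ^ q) := by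

  refine ⟨?_, ?_⟩
  · obtain ⟨H, s, hH, hP⟩ := exists_tvDerivBound_trans nrm hS h1 (q + 1)
    -- The `2` pays for the change of exponent in `TVDerivBound.mono`; the bound on `P` has rate
    -- `0`, so `γ₁` serves both.
    refine ⟨2 * max H₁ H, max s₁ s, γ₁, ?_, le_max_left _ _, le_rfl, ?_, ?_⟩
    · linarith [le_max_left H₁ H]
    · exact h4.mono nrm (fun t ht => ht.1) hH₁.le (by gcongr; exact le_max_left _ _)
        (le_max_left _ _) le_rfl
    · exact hP.mono nrm (fun t ht => le_of_lt ht) hH.le (by gcongr; exact le_max_right _ _)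
        (le_max_right _ _) hγ₁.le
  · intro H₀ s₀ γ₀ hH₀ _ hγ₀ hφ₀ hP₀
    refine ⟨⟨2 * H₀, by positivity, tvConsistent_of_tvDerivBound nrm hS h3 hH₀ hγ₀ hφ₀ hP₀⟩, ?_⟩
    intro C₀ _ hC T n m hm p₀ hp₀ Ω Ω' _ _ ℙ ℙ' _ _ X Y hX hY i
    refine ⟨momVar_law_sub_law_le nrm hS hφ h2 hC m hm hp₀ hX hY i, ?_⟩
    have hT : (m.t i : ℝ) ≤ T := by
      exact_mod_cast (m.strictMono.monotone (Fin.le_last i)).trans_eq m.t_last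
    have hμ : 0 ≤ max (lam s₀) γ₀ := hγ₀.le.trans (le_max_right _ _)
    have hsz := m.size_nonneg
    gcongr
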